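/- Let $d\ge 2$. A set $Y\subseteq\mathbb{R}^d$ is a Danzer set if it intersects every convex subset of $\mathbb{R}^d$ of volume $1$. For an integer $k\ge 1$ write $\mathbb{R}^{d+k}=\mathbb{R}^d\oplus\mathbb{R}^k$ with projections $\pi_{phys}:\mathbb{R}^{d+k}\to\mathbb{R}^d$ and $\pi_{int}:\mathbb{R}^{d+k}\to\mathbb{R}^k$. A cut-and-project set in $\mathbb{R}^d$ is a set of the form $\Lambda(L,W)=\pi_{phys}\left(L\cap\pi_{int}^{-1}(W)\right)$, where $k\ge 1$ is an integer, $L\subseteq\mathbb{R}^{d+k}$ is a grid (a translate of a lattice, i.e. of a discrete subgroup spanning $\mathbb{R}^{d+k}$) and $W\subseteq\mathbb{R}^k$ is a bounded set. Let $\Lambda_1,\dots,\Lambda_r\subseteq\mathbb{R}^d$ be cut-and-project sets (the internal dimension, the grid and the window may depend on the index). Then $\Lambda_1\cup\dots\cup\Lambda_r$ is not a Danzer set. -/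

import Mathlib

open MeasureTheory

/-- A subset of `ℝ^d` is a Danzer set if it meets every convex subset of `ℝ^d` of volume `1`. -/
def IsDanzerSet {d : ℕ} (Y : Set (EuclideanSpace ℝ (Fin d))) : Prop :=
  ∀ C : Set (EuclideanSpace ℝ (Fin d)), Convex ℝ C → volume C = 1 → (Y ∩ C).Nonempty

/-- A grid in a finite-dimensional real vector space is a translate of a lattice, i.e. of a
discrete subgroup that spans the space over `ℝ`. -/
def IsGrid {E : Type*} [NormedAddCommGroup E] [NormedSpace ℝ E] (L : Set E) : Prop :=
  ∃ (L₀ : Submodule ℤ E) (_ : DiscreteTopology L₀) (v : E),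
    IsZLattice ℝ L₀ ∧ L = {x | ∃ y ∈ L₀, x = v + y}

/-- The set `Λ(L, W) = π_phys (L ∩ π_int⁻¹ (W))`. The full space `ℝ^n`, `n = d + k`, is the direct
sum `ℝ^d ⊕ ℝ^k` of the physical and the internal space, with projections `Prod.fst` and
`Prod.snd`. -/
def cutAndProject {d k : ℕ} (L : Set (EuclideanSpace ℝ (Fin d) × EuclideanSpace ℝ (Fin k)))
    (W : Set (EuclideanSpace ℝ (Fin k))) : Set (EuclideanSpace ℝ (Fin d)) :=
  Prod.fst '' (L ∩ Prod.snd ⁻¹' W)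

/-- `Λ ⊆ ℝ^d` is a cut-and-project set (model set) if `Λ = Λ(L, W)` for some internal dimension
`k ≥ 1`, some grid `L` in `ℝ^d ⊕ ℝ^k` and some bounded window `W ⊆ ℝ^k`. -/
def IsCutAndProjectSet {d : ℕ} (Λ : Set (EuclideanSpace ℝ (Fin d))) : Prop :=
  ∃ (k : ℕ) (L : Set (EuclideanSpace ℝ (Fin d) × EuclideanSpace ℝ (Fin k)))
    (W : Set (EuclideanSpace ℝ (Fin k))),
    1 ≤ k ∧ IsGrid L ∧ Bornology.IsBounded W ∧ Λ = cutAndProject L W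

/-! A dual lattice vector `(a, b)` with `b` tiny traps a cut-and-project set in thin parallel slabs
`⟪a, p⟫ ∈ c + ℤ ± δ`, because the window is bounded. Minkowski's theorem supplies such vectors with
`‖g a‖ ≤ R`, where `R` is the same for all `g` of determinant one. This uniformity allows an
induction over the sets (`exists_det_one_forall_short`) that yields one `g` making `g aᵢ` short for
every `i`. The image of the unit cube under the adjoint of `g` has volume one and is thin in every
direction `aᵢ`. Since the total relative width of the slabs is less than one, the image can be
translated off all of them. -/

/-- The dual of a lattice in `F ⊕ G`, for the pairing `⟪a, p⟫ + ⟪b, q⟫`. -/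
theorem exists_basis_int_pairing {F G : Type*} [NormedAddCommGroup F] [InnerProductSpace ℝ F]
    [FiniteDimensional ℝ F] [NormedAddCommGroup G] [InnerProductSpace ℝ G] [FiniteDimensional ℝ G]
    (L : Submodule ℤ (F × G)) [DiscreteTopology L] [IsZLattice ℝ L] :
    ∃ (ι : Type) (_ : Fintype ι) (b : Module.Basis ι ℝ (F × G)),
      ∀ y ∈ Submodule.span ℤ (Set.range b), ∀ x ∈ L,
        ∃ n : ℤ, inner ℝ y.1 x.1 + inner ℝ y.2 x.2 = n := by
  classical
  have := ZLattice.module_finite ℝ L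
  have := ZLattice.module_free ℝ L
  let c := Module.finBasis ℤ L
  let b := c.ofZLatticeBasis ℝ L
  let B : LinearMap.BilinForm ℝ (F × G) :=
    (innerₗ F).compl₁₂ (LinearMap.fst ℝ F G) (LinearMap.fst ℝ F G) +
      (innerₗ G).compl₁₂ (LinearMap.snd ℝ F G) (LinearMap.snd ℝ F G)
  have hB' : ∀ y x, B y x = inner ℝ y.1 x.1 + inner ℝ y.2 x.2 := fun y x ↦ rfl
  have hB : B.Nondegenerate := by
    have hsymm : B.IsSymm := ⟨fun y x ↦ by simp [hB', real_inner_comm]⟩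
    refine (LinearMap.IsRefl.nondegenerate_iff_separatingLeft hsymm.isRefl).mpr ?_
    intro y hy
    have h := hy y
    rw [hB', real_inner_self_eq_norm_sq, real_inner_self_eq_norm_sq] at h
    have h1 : ‖y.1‖ = 0 := by nlinarith [sq_nonneg ‖y.1‖, sq_nonneg ‖y.2‖]
    have h2 : ‖y.2‖ = 0 := by nlinarith [sq_nonneg ‖y.1‖, sq_nonneg ‖y.2‖]
    exact Prod.ext (norm_eq_zero.mp h1) (norm_eq_zero.mp h2)
  refine ⟨_, inferInstance, B.dualBasis hB b, fun y hy x hx ↦ ?_⟩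
  rw [← LinearMap.BilinForm.dualSubmodule_span_of_basis, c.ofZLatticeBasis_span ℝ] at hy
  obtain ⟨n, hn⟩ := Submodule.mem_one.mp (hy x hx)
  exact ⟨n, by rw [← hB', ← hn]; simp⟩

/-- Minkowski's theorem for the bodies `g⁻¹ (ball R) × ball ε`, uniformly over `g` with
determinant one. -/
theorem exists_short_vector {F G : Type*} [NormedAddCommGroup F] [InnerProductSpace ℝ F]
    [FiniteDimensional ℝ F] [Nontrivial F]
    [NormedAddCommGroup G] [InnerProductSpace ℝ G] [FiniteDimensional ℝ G]
    {ι : Type*} [Fintype ι] (b : Module.Basis ι ℝ (F × G)) {ε : ℝ} (hε : 0 < ε) :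
    ∃ R : ℝ, ∀ g : F →ₗ[ℝ] F, LinearMap.det g = 1 →
      ∃ y ∈ Submodule.span ℤ (Set.range b), y ≠ 0 ∧ ‖g y.1‖ ≤ R ∧ ‖y.2‖ ≤ ε := by
  borelize F G
  have : NoncompactSpace F := NormedSpace.noncompactSpace ℝ F
  let μ : Measure F := Measure.addHaar
  let ν : Measure G := Measure.addHaar
  let K : ENNReal := (μ.prod ν) (ZSpan.fundamentalDomain b) * 2 ^ Module.finrank ℝ (F × G)
  have hν : ν (Metric.ball 0 ε) ≠ 0 := (Metric.measure_ball_pos ν 0 hε).ne'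
  have hν' : ν (Metric.ball 0 ε) ≠ ⊤ := measure_ball_lt_top.ne
  have hK : K < ⊤ := ENNReal.mul_lt_top (ZSpan.fundamentalDomain_isBounded b).measure_lt_top
    (by simp)
  obtain ⟨R, hR⟩ : ∃ R : ℝ, K < μ (Metric.ball 0 R) * ν (Metric.ball 0 ε) := by
    have h : Filter.Tendsto (fun n : ℕ ↦ μ (Metric.ball (0 : F) n)) Filter.atTop
        (nhds (μ Set.univ)) := by
      rw [← Metric.iUnion_ball_nat (0 : F)]
      exact tendsto_measure_iUnion_atTop fun m n h ↦
        Metric.ball_subset_ball (Nat.cast_le.mpr h)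
    -- A nontrivial `F` has infinite Haar measure, so a large ball beats any finite bound.
    have h2 : K / ν (Metric.ball 0 ε) < μ Set.univ := by
      rw [measure_univ_of_isAddLeftInvariant μ]
      exact ENNReal.div_lt_top hK.ne hν
    obtain ⟨n, hn⟩ := (h.eventually_const_lt h2).exists
    exact ⟨n, (ENNReal.div_lt_iff (.inl hν) (.inl hν')).mp hn⟩
  refine ⟨R, fun g hg ↦ ?_⟩
  have hs : (μ.prod ν) ((g ⁻¹' Metric.ball 0 R) ×ˢ Metric.ball 0 ε) =
      μ (Metric.ball 0 R) * ν (Metric.ball 0 ε) := by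
    rw [Measure.prod_prod, Measure.addHaar_preimage_linearMap μ (by simp [hg])]
    simp [hg]
  have : Countable (Submodule.span ℤ (Set.range b)).toAddSubgroup :=
    inferInstanceAs (Countable (Submodule.span ℤ (Set.range b)))
  have hfund := ZSpan.isAddFundamentalDomain' b (μ.prod ν)
  obtain ⟨y, hy, hmem⟩ := exists_ne_zero_mem_lattice_of_measure_mul_two_pow_lt_measure
    (s := (g ⁻¹' Metric.ball 0 R) ×ˢ Metric.ball 0 ε) hfund
    (fun x hx ↦ by simpa using hx)
    (((convex_ball 0 R).linear_preimage g).prod (convex_ball 0 ε)) (by rw [hs]; exact hR)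
  simp only [Set.mem_prod, Set.mem_preimage, mem_ball_zero_iff] at hmem
  exact ⟨y, y.2, by simpa using hy, hmem.1.le, hmem.2.le⟩

/-- A map of determinant one that shrinks a given vector and expands by a bounded factor. -/
theorem exists_det_one_contraction {F : Type*} [NormedAddCommGroup F] [InnerProductSpace ℝ F]
    [FiniteDimensional ℝ F] (hF : 2 ≤ Module.finrank ℝ F) (R : ℝ) {η : ℝ} (hη : 0 < η) :
    ∃ M : ℝ, 0 < M ∧ ∀ v : F, ‖v‖ ≤ R → ∃ h : F →ₗ[ℝ] F, LinearMap.det h = 1 ∧ ‖h v‖ ≤ η ∧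
      ∀ w, ‖h w‖ ≤ M * ‖w‖ := by
  let M : ℝ := max 1 (R / η)
  have hM1 : 1 ≤ M := le_max_left _ _
  have hM0 : 0 < M := by positivity
  have hMR : R ≤ M * η := (div_le_iff₀ hη).mp (le_max_right _ _)
  refine ⟨2 * M, by positivity, fun v hv ↦ ?_⟩
  rcases eq_or_ne v 0 with rfl | hv0
  · refine ⟨LinearMap.id, by simp, by simpa using hη.le, fun w ↦ ?_⟩
    rw [LinearMap.id_apply]
    nlinarith [norm_nonneg w]
  let u : F := (‖v‖⁻¹ : ℝ) • v
  have hu : ‖u‖ = 1 := norm_smul_inv_norm hv0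
  have huu : inner ℝ u u = (1 : ℝ) := by rw [real_inner_self_eq_norm_sq, hu, one_pow]
  let n := Module.finrank ℝ F
  -- `h` below scales `u` by `M ^ (1 - n)` and its orthogonal complement by `M`. As `n ≥ 2`, this
  -- shrinks `v` at least by the factor `M`.
  let c : ℝ := (M ^ n)⁻¹ - 1
  have hn : M ^ 2 ≤ M ^ n := pow_le_pow_right₀ hM1 hF
  have hc1 : 1 + c = (M ^ n)⁻¹ := by simp [c]
  have hpos : 0 < (M ^ n)⁻¹ := by positivity
  have hle : (M ^ n)⁻¹ ≤ 1 := inv_le_one_of_one_le₀ (one_le_pow₀ hM1)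
  let f : F →ₗ[ℝ] ℝ := innerₗ F u
  have hfu : f u = 1 := huu
  let h : F →ₗ[ℝ] F := M • LinearMap.transvection (c • f) u
  have happ : ∀ w, h w = M • (w + (c * inner ℝ u w) • u) := fun w ↦ by
    simp [h, f, LinearMap.transvection.apply]
  refine ⟨h, ?_, ?_, fun w ↦ ?_⟩
  · rw [LinearMap.det_smul, LinearMap.transvection.det]
    simp only [LinearMap.smul_apply, hfu, smul_eq_mul, mul_one, hc1]
    exact mul_inv_cancel₀ (by positivity)
  · have hvu : v = ‖v‖ • u := by simp [u, smul_smul, hv0]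
    have : h v = (M * ‖v‖ * (M ^ n)⁻¹) • u := by
      rw [happ]
      conv_lhs => rw [hvu]
      rw [inner_smul_right, huu, ← hc1]
      module
    rw [this, norm_smul, hu, mul_one, Real.norm_of_nonneg (by positivity)]
    rw [← div_eq_mul_inv, div_le_iff₀ (by positivity)]
    calc M * ‖v‖ ≤ M * (M * η) := by gcongr; exact hv.trans hMR
      _ = η * M ^ 2 := by ring
      _ ≤ η * M ^ n := by gcongr
  · have h1 : |inner ℝ u w| ≤ ‖w‖ := by simpa [hu] using abs_real_inner_le_norm u w
    have h2 : |c| ≤ 1 := abs_le.mpr ⟨by linarith, by linarith⟩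
    rw [happ, norm_smul, Real.norm_of_nonneg hM0.le]
    have : ‖w + (c * inner ℝ u w) • u‖ ≤ ‖w‖ + 1 * ‖w‖ := by
      refine (norm_add_le _ _).trans ?_
      rw [norm_smul, hu, mul_one, Real.norm_eq_abs, abs_mul]
      gcongr
    nlinarith

/-- If each `A i` meets every `g⁻¹ (ball (R i))`, `det g = 1`, then some `g` of determinant one
makes an element of every `A i` short. -/
theorem exists_det_one_forall_short {F : Type*} [NormedAddCommGroup F] [InnerProductSpace ℝ F]
    [FiniteDimensional ℝ F] (hF : 2 ≤ Module.finrank ℝ F) {κ : Type*} (s : Finset κ)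
    (A : κ → Set F)
    (hA : ∀ i, ∃ R : ℝ, ∀ g : F →ₗ[ℝ] F, LinearMap.det g = 1 → ∃ a ∈ A i, ‖g a‖ ≤ R) :
    ∀ η : ℝ, 0 < η → ∃ g : F →ₗ[ℝ] F, LinearMap.det g = 1 ∧ ∀ i ∈ s, ∃ a ∈ A i, ‖g a‖ ≤ η := by
  classical
  induction s using Finset.induction_on with
  | empty => exact fun η _ ↦ ⟨LinearMap.id, by simp, by simp⟩
  | insert j s hj ih =>
    intro η hη
    obtain ⟨R, hR⟩ := hA j
    obtain ⟨M, hM, hcontr⟩ := exists_det_one_contraction hF R hη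
    -- `M` depends on `R` but not on `g`, so the earlier vectors can be made short enough in advance
    -- to survive the expansion by `h`.
    obtain ⟨g, hg, hs⟩ := ih (η / M) (by positivity)
    obtain ⟨a, ha, hga⟩ := hR g hg
    obtain ⟨h, hh, hha, hhM⟩ := hcontr (g a) hga
    refine ⟨h ∘ₗ g, by rw [LinearMap.det_comp, hh, hg, one_mul], fun i hi ↦ ?_⟩
    rcases Finset.mem_insert.mp hi with rfl | hi
    · exact ⟨a, ha, hha⟩
    · obtain ⟨a', ha', hle⟩ := hs i hi
      refine ⟨a', ha', (hhM _).trans ?_⟩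
      rw [mul_comm]
      exact (le_div_iff₀ hM).mp hle

/-- The points of `[0, T]` that are mapped by `s ↦ s * a - c` close to an integer have small
measure. -/
theorem volume_near_int_le {a : ℝ} (ha : 0 < a) (c : ℝ) {δ T : ℝ} (hδ : 0 < δ) (hδ1 : δ ≤ 1)
    (hT : 0 < T) :
    volume {s ∈ Set.Icc 0 T | ∃ n : ℤ, |s * a - c - n| ≤ δ} ≤
      ENNReal.ofReal ((T * a + 3) * (2 * (δ / a))) := by
  let N := Finset.Icc ⌈-c - 1⌉ ⌊T * a - c + 1⌋
  have hsub : {s ∈ Set.Icc 0 T | ∃ n : ℤ, |s * a - c - n| ≤ δ} ⊆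
      ⋃ n ∈ N, Metric.closedBall ((n + c) / a) (δ / a) := by
    rintro s ⟨⟨hs0, hsT⟩, n, hn⟩
    have h1 : s * a ≤ T * a := by gcongr
    have h0 : 0 ≤ s * a := by positivity
    have hn' := abs_le.mp hn
    simp only [Set.mem_iUnion, N, Finset.mem_Icc, Int.ceil_le, Int.le_floor]
    refine ⟨n, ⟨by linarith, by linarith⟩, ?_⟩
    rw [Metric.mem_closedBall, Real.dist_eq, le_div_iff₀ ha]
    calc |s - (n + c) / a| * a = |(s - (n + c) / a) * a| := by rw [abs_mul, abs_of_pos ha]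
      _ = |s * a - c - n| := by congr 1; field_simp; ring
      _ ≤ δ := hn
  have hcard : (N.card : ℝ) ≤ T * a + 3 := by
    rw [Int.card_Icc]
    have h1 := Int.floor_le (T * a - c + 1)
    have h2 := Int.le_ceil (-c - 1)
    have h3 : (((⌊T * a - c + 1⌋ + 1 - ⌈-c - 1⌉).toNat : ℤ) : ℝ) =
        ((max (⌊T * a - c + 1⌋ + 1 - ⌈-c - 1⌉) 0 : ℤ) : ℝ) := by rw [Int.toNat_eq_max]
    rw [Int.cast_natCast] at h3
    rw [h3]
    push_cast
    exact max_le (by linarith) (by positivity)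
  calc _ ≤ volume (⋃ n ∈ N, Metric.closedBall (((n : ℝ) + c) / a) (δ / a)) := measure_mono hsub
    _ ≤ ∑ n ∈ N, volume (Metric.closedBall (((n : ℝ) + c) / a) (δ / a)) :=
      measure_biUnion_finset_le _ _
    _ = ENNReal.ofReal (N.card * (2 * (δ / a))) := by
      simp only [Real.volume_closedBall, Finset.sum_const, nsmul_eq_mul]
      rw [ENNReal.ofReal_mul (p := (N.card : ℝ)) (by positivity), ENNReal.ofReal_natCast]
    _ ≤ _ := by gcongr

/-- Finitely many nonconstant affine functions of one variable are simultaneously far from `ℤ`, by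
a margin that depends only on their number. -/
theorem exists_far_from_int {κ : Type*} [Fintype κ] (a c : κ → ℝ) (ha : ∀ i, a i ≠ 0)
    {δ : ℝ} (hδ : 0 < δ) (hδ1 : 2 * δ * (Fintype.card κ + 1) ≤ 1) :
    ∃ s : ℝ, ∀ i, ∀ n : ℤ, δ < |s * a i - c i - n| := by
  wlog hpos : ∀ i, 0 < a i generalizing a c
  · obtain ⟨s, hs⟩ := this (fun i ↦ |a i|) (fun i ↦ SignType.sign (a i) * c i)
      (fun i ↦ abs_ne_zero.mpr (ha i)) (fun i ↦ abs_pos.mpr (ha i))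
    refine ⟨s, fun i n ↦ ?_⟩
    rcases (ha i).lt_or_gt with h | h
    · have := hs i (-n)
      simp only [abs_of_neg h, sign_neg h] at this
      rw [← abs_neg]
      convert this using 2
      push_cast
      simp
      ring
    · simpa [abs_of_pos h, sign_pos h] using hs i n
  have hδ2 : δ ≤ 1 := by
    have : (0 : ℝ) ≤ Fintype.card κ := by positivity
    nlinarith
  let S : ℝ := ∑ i, 3 * (2 * (δ / a i))
  have hS : 0 ≤ S := Finset.sum_nonneg fun i _ ↦ by have := hpos i; positivity
  -- A cover of `[0, T]` would give `T ≤ (1 - 2 * δ) * T + S`, that is `2 * δ * T ≤ S`.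
  let T : ℝ := (S + 1) / (2 * δ)
  have hT : 0 < T := by positivity
  by_contra! hcon
  have hsub : Set.Icc 0 T ⊆ ⋃ i, {s ∈ Set.Icc 0 T | ∃ n : ℤ, |s * a i - c i - n| ≤ δ} := by
    intro s hs
    obtain ⟨i, n, h⟩ := hcon s
    exact Set.mem_iUnion.mpr ⟨i, hs, n, h⟩
  have hvol : ENNReal.ofReal T ≤ ENNReal.ofReal (∑ i, (T * a i + 3) * (2 * (δ / a i))) := by
    calc ENNReal.ofReal T = volume (Set.Icc 0 T) := by simp
      _ ≤ _ := measure_mono hsub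
      _ ≤ ∑ i, volume {s ∈ Set.Icc 0 T | ∃ n : ℤ, |s * a i - c i - n| ≤ δ} :=
        measure_iUnion_fintype_le _ _
      _ ≤ ∑ i, ENNReal.ofReal ((T * a i + 3) * (2 * (δ / a i))) :=
        Finset.sum_le_sum fun i _ ↦ volume_near_int_le (hpos i) (c i) hδ hδ2 hT
      _ = _ := (ENNReal.ofReal_sum_of_nonneg fun i _ ↦ by have := hpos i; positivity).symm
  have hsum : ∑ i, (T * a i + 3) * (2 * (δ / a i)) = Fintype.card κ * (2 * δ * T) + S := by
    rw [← nsmul_eq_mul, ← Finset.card_univ, ← Finset.sum_const, ← Finset.sum_add_distrib]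
    refine Finset.sum_congr rfl fun i _ ↦ ?_
    have := (hpos i).ne'
    field_simp
  rw [hsum, ENNReal.ofReal_le_ofReal_iff (by positivity)] at hvol
  have hTδ : 2 * δ * T = S + 1 := by simp only [T]; field_simp
  nlinarith

/-- Finitely many slab systems of small relative width do not cover an inner product space. -/
theorem exists_inner_far_from_int {F : Type*} [NormedAddCommGroup F] [InnerProductSpace ℝ F]
    {κ : Type*} [Fintype κ] (a : κ → F) (c : κ → ℝ) (ha : ∀ i, a i ≠ 0)
    {δ : ℝ} (hδ : 0 < δ) (hδ1 : 2 * δ * (Fintype.card κ + 1) ≤ 1) :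
    ∃ t : F, ∀ i, ∀ n : ℤ, δ < |inner ℝ (a i) t - c i - n| := by
  -- Restricting to a line whose direction is orthogonal to no `a i` leaves a one-variable problem.
  obtain ⟨u, hu⟩ := Module.Dual.exists_forall_ne_zero_of_forall_exists
    (fun i ↦ innerₗ F (a i)) fun i ↦ ⟨a i, by simpa using ha i⟩
  obtain ⟨s, hs⟩ := exists_far_from_int (fun i ↦ inner ℝ (a i) u) c hu hδ hδ1
  exact ⟨s • u, by simpa [inner_smul_right] using hs⟩

/-- A cut-and-project set lies in the union of the slabs of width `2δ` around the hyperplanes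
`⟪a, p⟫ ∈ c + ℤ`, for many vectors `a`. -/
theorem IsCutAndProjectSet.exists_slabs {d : ℕ} (hd : d ≠ 0) {Λ : Set (EuclideanSpace ℝ (Fin d))}
    (hΛ : IsCutAndProjectSet Λ) {δ : ℝ} (hδ : 0 < δ) :
    ∃ A : Set (EuclideanSpace ℝ (Fin d)), 0 ∉ A ∧
      (∃ R : ℝ, ∀ g : EuclideanSpace ℝ (Fin d) →ₗ[ℝ] EuclideanSpace ℝ (Fin d),
        LinearMap.det g = 1 → ∃ a ∈ A, ‖g a‖ ≤ R) ∧
      ∀ a ∈ A, ∃ c : ℝ, ∀ p ∈ Λ, ∃ n : ℤ, |inner ℝ a p - c - n| ≤ δ := by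
  obtain ⟨k, L, W, -, ⟨L₀, _, v, _, rfl⟩, hW, rfl⟩ := hΛ
  have : NeZero d := ⟨hd⟩
  obtain ⟨ι, _, b, hb⟩ := exists_basis_int_pairing L₀
  obtain ⟨B, hB0, hB⟩ := hW.exists_pos_norm_le
  obtain ⟨ε₀, hε₀, hdisc⟩ := Metric.isOpen_singleton_iff.mp
    (isOpen_discrete ({0} : Set (Submodule.span ℤ (Set.range b))))
  -- The first bound excludes nonzero dual vectors with zero physical part; the second keeps the
  -- internal term of the pairing below `δ` on the window.
  let ε : ℝ := min (ε₀ / 2) (δ / B)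
  have hε : 0 < ε := by positivity
  have hεε₀ : ε < ε₀ := (min_le_left _ _).trans_lt (half_lt_self hε₀)
  have hεB : ε * B ≤ δ := (le_div_iff₀ hB0).mp (min_le_right _ _)
  refine ⟨{a | ∃ y ∈ Submodule.span ℤ (Set.range b), y ≠ 0 ∧ ‖y.2‖ ≤ ε ∧ y.1 = a}, ?_, ?_, ?_⟩
  · rintro ⟨y, hy, hy0, hyε, hy1⟩
    have h := hdisc ⟨y, hy⟩ (by
      rw [dist_zero_right, Submodule.coe_norm, Prod.norm_def, hy1, norm_zero]
      exact max_lt hε₀ (hyε.trans_lt hεε₀))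
    exact hy0 (congrArg Subtype.val h)
  · obtain ⟨R, hR⟩ := exists_short_vector b hε
    refine ⟨R, fun g hg ↦ ?_⟩
    obtain ⟨y, hy, hy0, hyR, hyε⟩ := hR g hg
    exact ⟨y.1, ⟨y, hy, hy0, hyε, rfl⟩, hyR⟩
  · rintro _ ⟨y, hy, -, hyε, rfl⟩
    refine ⟨inner ℝ y.1 v.1 + inner ℝ y.2 v.2, ?_⟩
    rintro _ ⟨_, ⟨⟨x, hx, rfl⟩, hxW⟩, rfl⟩
    obtain ⟨n, hn⟩ := hb y hy x hx
    have hinner : |inner ℝ y.2 (v + x).2| ≤ δ := by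
      refine (abs_real_inner_le_norm _ _).trans (le_trans ?_ hεB)
      gcongr
      exact hB _ hxW
    refine ⟨n, ?_⟩
    rw [← hn, ← abs_neg]
    convert hinner using 2
    simp only [Prod.fst_add, Prod.snd_add, inner_add_right]
    ring

theorem theorem1p2 (d : ℕ) (hd : 2 ≤ d) (r : ℕ) (Λ : Fin r → Set (EuclideanSpace ℝ (Fin d)))
    (hΛ : ∀ i, IsCutAndProjectSet (Λ i)) : ¬ IsDanzerSet (⋃ i, Λ i) := by
  intro hDanzer
  let δ : ℝ := 1 / (4 * (r + 1))
  have hδ : 0 < δ := by positivity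
  have hδr : 2 * (2 * δ) * (Fintype.card (Fin r) + 1) ≤ 1 := by
    rw [Fintype.card_fin]
    simp only [δ]
    field_simp
    norm_num
  choose A hA0 hAR hAc using fun i ↦ (hΛ i).exists_slabs (by omega) hδ
  let e := EuclideanSpace.basisFun (Fin d) ℝ
  obtain ⟨ρ, hρ, hQ⟩ := (e.toBasis.parallelepiped.isCompact.isBounded).exists_pos_norm_le
  obtain ⟨g, hg, hshort⟩ := exists_det_one_forall_short (by simpa using hd) Finset.univ A hAR
    (δ / ρ) (by positivity)
  choose a haA hga using fun i ↦ hshort i (Finset.mem_univ i)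
  choose c hc using fun i ↦ hAc i (a i) (haA i)
  -- The margin `2 * δ` pays once for the slabs and once for the extent of the convex body.
  obtain ⟨t, ht⟩ := exists_inner_far_from_int a c
    (fun i h ↦ hA0 i (h ▸ haA i)) (δ := 2 * δ) (by positivity) hδr
  let Q := parallelepiped e
  have hdet : LinearMap.det (LinearMap.adjoint g) = 1 := by
    rw [← LinearMap.det_toMatrix e.toBasis, LinearMap.toMatrix_adjoint, Matrix.det_conjTranspose,
      LinearMap.det_toMatrix, hg, star_one]
  have hvol : volume ((fun x ↦ t + x) '' (LinearMap.adjoint g '' Q)) = 1 := by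
    rw [Set.image_add_left, measure_preimage_add, Measure.addHaar_image_linearMap, hdet,
      e.volume_parallelepiped]
    simp
  obtain ⟨_, hmem, _, ⟨q, hq, rfl⟩, rfl⟩ := hDanzer _
    (((convex_parallelepiped e).linear_image (LinearMap.adjoint g)).translate t) hvol
  obtain ⟨i, hi⟩ := Set.mem_iUnion.mp hmem
  obtain ⟨n, hn⟩ := hc i _ hi
  have hinner : |inner ℝ (a i) (LinearMap.adjoint g q)| ≤ δ := by
    rw [LinearMap.adjoint_inner_right]
    refine (abs_real_inner_le_norm _ _).trans ?_
    calc ‖g (a i)‖ * ‖q‖ ≤ δ / ρ * ρ := by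
          gcongr
          · exact hga i
          · exact hQ q (by simpa using hq)
      _ = δ := div_mul_cancel₀ _ hρ.ne'
  rw [inner_add_right] at hn
  refine (ht i n).not_ge ?_
  rw [abs_le] at hn hinner ⊢
  constructor <;> linarith
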